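/- Let $K:\mathbb{R}\times\mathbb{R}\to\mathbb{R}$, $K(x,y)=\max(1+xy,0)$, be the Jain–Karlin–Schoenberg kernel, and let $K^\alpha$ denote its pointwise power, with the convention $0^0:=0$. For totally ordered sets $X,Y$, a kernel $L:X\times Y\to\mathbb{R}$ is called $\mathrm{TN}_p$ (respectively $\mathrm{TP}_p$) if for all integers $1\le r\le p$ and all $x_1<\cdots<x_r$ in $X$, $y_1<\cdots<y_r$ in $Y$, the determinant $\det(L(x_j,y_k))_{j,k=1}^r$ is non-negative (respectively positive); it is called $\mathrm{TN}$ (respectively $\mathrm{TP}$) if this holds for all $p\ge 1$. A $p\times p$ matrix is regarded as a kernel on $\{1,\dots,p\}\times\{1,\dots,p\}$. Let $p\ge 2$ be an integer and let $\alpha\ge 0$ be real. (1) If $\alpha\ge p-2$, then $K^\alpha$ is $\mathrm{TN}_p$ on $\mathbb{R}\times\mathbb{R}$. (2) If $K^\alpha$ is $\mathrm{TN}_p$ on $\mathbb{R}\times\mathbb{R}$, then $\alpha\in\mathbb{Z}_{\ge 0}\cup[p-2,\infty)$. More strongly, for all real numbers $x_1<\cdots<x_p$ and $y_1<\cdots<y_p$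 with $1+x_jy_k>0$ for all $j,k$, the matrix $(K(x_j,y_k)^\alpha)_{j,k=1}^p=((1+x_jy_k)^\alpha)_{j,k=1}^p$ is (a) $\mathrm{TP}$ if $\alpha>p-2$; (b) $\mathrm{TN}$ if $\alpha\in\{0,1,\dots,p-2\}$; (c) not $\mathrm{TN}$ if $\alpha\in(0,p-2)\setminus\mathbb{Z}$. (3) Let $I\subset\mathbb{R}$ be an interval containing more than one point, with $I\subset[0,\infty)$ or $I\subset(-\infty,0]$. Then $K^\alpha$ is $\mathrm{TN}_p$ on $I\times\mathbb{R}$ if and only if $\alpha\in\mathbb{Z}_{\ge 0}\cup[p-2,\infty)$, and likewise $K^\alpha$ is $\mathrm{TN}_p$ on $\mathbb{R}\times I$ if and only if $\alpha\in\mathbb{Z}_{\ge 0}\cup[p-2,\infty)$. In particular, if $\alpha\in\mathbb{Z}_{\ge 0}$, then $K^\alpha$ is $\mathrm{TN}$ on $I\times\mathbb{R}$ and on $\mathbb{R}\times I$. -/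

import Mathlib

/-- A kernel `K : X × Y → ℝ` on totally ordered sets is totally non-negative of order `p` (`TN_p`)
if for all `1 ≤ r ≤ p` and all strictly increasing `r`-tuples `x` in `X` and `y` in `Y`,
`det (K (x_j, y_k))_{j,k=1}^r ≥ 0`. -/
def IsTNOrder {X Y : Type*} [LinearOrder X] [LinearOrder Y] (p : ℕ) (K : X → Y → ℝ) : Prop :=
  ∀ r : ℕ, 1 ≤ r → r ≤ p → ∀ x : Fin r → X, StrictMono x → ∀ y : Fin r → Y, StrictMono y →
    0 ≤ (Matrix.of fun j k : Fin r => K (x j) (y k)).det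

/-- A kernel is totally non-negative (`TN`) if it is `TN_p` for all `p ≥ 1`. -/
def IsTN {X Y : Type*} [LinearOrder X] [LinearOrder Y] (K : X → Y → ℝ) : Prop :=
  ∀ p : ℕ, 1 ≤ p → IsTNOrder p K

/-- A kernel is totally positive of order `p` (`TP_p`) if the same determinants are positive. -/
def IsTPOrder {X Y : Type*} [LinearOrder X] [LinearOrder Y] (p : ℕ) (K : X → Y → ℝ) : Prop :=
  ∀ r : ℕ, 1 ≤ r → r ≤ p → ∀ x : Fin r → X, StrictMono x → ∀ y : Fin r → Y, StrictMono y →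
    0 < (Matrix.of fun j k : Fin r => K (x j) (y k)).det

/-- A kernel is totally positive (`TP`) if it is `TP_p` for all `p ≥ 1`. -/
def IsTP {X Y : Type*} [LinearOrder X] [LinearOrder Y] (K : X → Y → ℝ) : Prop :=
  ∀ p : ℕ, 1 ≤ p → IsTPOrder p K

/-- The Jain–Karlin–Schoenberg kernel `K(x, y) = max (1 + x y, 0)` on `ℝ × ℝ`. -/
noncomputable def jksKernel (x y : ℝ) : ℝ := max (1 + x * y) 0

/-- The power `t ^ α` of a real `t ≥ 0` to an exponent `α ≥ 0`, with the convention `0 ^ 0 = 0`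
(Mathlib's real power has `0 ^ 0 = 1`; the two agree in all other cases). -/
noncomputable def zeroPow (t α : ℝ) : ℝ := if t = 0 then 0 else t ^ α

/-- The pointwise power `K ^ α` of the Jain–Karlin–Schoenberg kernel, with `0 ^ 0 = 0`. -/
noncomputable def jksPow (α x y : ℝ) : ℝ := zeroPow (jksKernel x y) α

/-! With x = tan a and y = tan b, 1 + xy = cos(a - b) / (cos a cos b), so up to positive row and
column factors K^α is the truncated kernel `cosBump α (a - b)` (`jksPow_eq_cosBump`).

One reduction drives everything and lowers order and exponent by one. Dividing row j by the α-th
power of the absolute value of its untruncated first entry turns the first column into 1, …, 1, 0,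
…, 0, the zeros coming from truncation; differences of consecutive rows then remove it. If u(t),
v(t) are both shifted cosines, or both of the form 1 + ty, then (u/v)^α has derivative α W u^(α-1) /
v^(α+1), where W = u'v - uv' does not depend on t. So W is a column factor, positive for ordered
nodes, v gives a row factor, and the same kernel with exponent α - 1 remains.

For the truncated kernel this preserves non-negativity (`det_cosBump_nonneg_of_pred`). Descending to
order one settles α > p - 2, and a limit settles α = p - 2. If truncation occurs on one side only,
as on a half-plane, a natural exponent can instead descend to 0, where the matrices are 0/1
staircases.

For positive entries the mean value theorem makes the reduction an identity
(`exists_det_one_add_mul_rpow_eq`). A determinant of order n + 1 thus has the sign of α^n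
(α-1)^(n-1) ⋯ (α-n+1), which gives the positive, zero and negative cases; the negative one yields
necessity. -/

/-! ### Row operations on determinants -/

/-- A determinant stays the same when each row loses a multiple of the row below it. -/
theorem det_eq_of_forall_row_eq_smul_add_succ {n : ℕ} {A B : Matrix (Fin (n + 1)) (Fin (n + 1)) ℝ}
    (c : Fin n → ℝ) (A_last : ∀ k, A (Fin.last n) k = B (Fin.last n) k)
    (A_castSucc : ∀ (i : Fin n) (k), A i.castSucc k = B i.castSucc k + c i * A i.succ k) :
    A.det = B.det := by
  rw [← Matrix.det_submatrix_equiv_self Fin.revPerm A, ← Matrix.det_submatrix_equiv_self Fin.revPerm B]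
  refine Matrix.det_eq_of_forall_row_eq_smul_add_pred (fun i => c i.rev) ?_ ?_
  · intro j
    simp [A_last]
  · intro i j
    simp only [Matrix.submatrix_apply, Fin.revPerm_apply, Fin.rev_succ, Fin.rev_castSucc]
    exact A_castSucc _ _

/-- If the first column is `(1, …, 1, 0, …, 0)`, the determinant is that of differences of
consecutive rows: backwards where the first entry is `1`, forwards (up to a final zero row)
where it is `0`. -/
theorem det_eq_det_row_differences {n : ℕ} (E : Fin (n + 2) → Fin (n + 1) → ℝ)
    (L : Fin (n + 1) → Prop) [DecidablePred L] (h0 : L 0)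
    (hL : ∀ i : Fin n, L i.succ → L i.castSucc)
    (hE : ∀ j : Fin (n + 1), E j.castSucc 0 = if L j then 1 else 0)
    (hlast : ∀ k, E (Fin.last (n + 1)) k = 0) :
    (Matrix.of fun j k : Fin (n + 1) => E j.castSucc k).det =
      (Matrix.of fun i k : Fin n =>
        if L i.succ then E i.succ.castSucc k.succ - E i.castSucc.castSucc k.succ
        else E i.succ.castSucc k.succ - E i.succ.succ k.succ).det := by
  -- `B` carries out only the backward differences and `C` adds the forward ones. Below a row
  -- outside `L` lie only rows outside `L`, still untouched in `B`.
  set B : Matrix (Fin (n + 1)) (Fin (n + 1)) ℝ :=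
    Matrix.of (Fin.cons (fun k => E (Fin.castSucc 0) k) (fun (i : Fin n) k =>
      if L i.succ then E i.succ.castSucc k - E i.castSucc.castSucc k else E i.succ.castSucc k))
    with hB
  set C : Matrix (Fin (n + 1)) (Fin (n + 1)) ℝ :=
    Matrix.of (Fin.cons (fun k => E (Fin.castSucc 0) k) (fun (i : Fin n) k =>
      if L i.succ then E i.succ.castSucc k - E i.castSucc.castSucc k
      else E i.succ.castSucc k - E i.succ.succ k)) with hC
  have h1 : (Matrix.of fun j k : Fin (n + 1) => E j.castSucc k).det = B.det := by
    refine Matrix.det_eq_of_forall_row_eq_smul_add_pred (fun i => if L i.succ then 1 else 0) ?_ ?_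
    · intro k
      simp [hB]
    · intro i k
      by_cases h : L i.succ <;> simp [hB, h]
  have h2 : B.det = C.det := by
    refine det_eq_of_forall_row_eq_smul_add_succ (fun i => if L i.castSucc then 0 else 1) ?_ ?_
    · intro k
      cases n with
      | zero => simp [hB, hC]
      | succ n =>
        rw [← Fin.succ_last]
        by_cases h : L (Fin.last n).succ
        · simp only [hB, hC, h, Matrix.of_apply, Fin.cons_succ, if_true]
        · have := hlast k
          rw [← Fin.succ_last, ← Fin.succ_last] at this
          simp only [hB, hC, h, Matrix.of_apply, Fin.cons_succ, if_false]
          rw [this]; simp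
    · intro i k
      by_cases h : L i.castSucc
      · revert h
        refine Fin.cases (motive := fun j => L j → B j k = C j k + (if L j then 0 else 1) * B i.succ k)
          ?_ ?_ i.castSucc
        · intro h; simp [hB, hC, h]
        · intro j h; simp [hB, hC, h]
      · have h' : ¬ L i.succ := fun h' => h (hL i h')
        have h3 : B i.succ k = E i.succ.castSucc k := by simp [hB, h']
        rw [h3, ← Fin.succ_castSucc]
        revert h
        refine Fin.cases (motive := fun j => ¬ L j → B j k = C j k + (if L j then 0 else 1) * E j.succ k)
          ?_ ?_ i.castSucc
        · intro h; exact absurd h0 h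
        · intro j h; simp [hB, hC, h]
  -- The first column of `C` is now (1, 0, …, 0), so only one cofactor survives.
  rw [h1, h2, Matrix.det_succ_column_zero, Fin.sum_univ_succ, Finset.sum_eq_zero]
  · have : C 0 0 = 1 := by
      have := hE 0
      simp only [h0, if_true] at this
      simpa [hC] using this
    rw [this]
    simp only [Fin.val_zero, pow_zero, one_mul, add_zero]
    congr 1
  · intro i _
    have : C i.succ 0 = 0 := by
      have e1 := hE i.succ
      have e2 := hE i.castSucc
      by_cases h : L i.succ
      · simp only [h, hL i h, if_true] at e1 e2
        simp only [hC, h, Matrix.of_apply, Fin.cons_succ, if_true, e1, e2, sub_self]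
      · simp only [h, if_false] at e1
        have e3 : E i.succ.succ 0 = 0 := by
          by_cases hi : i.succ = Fin.last n
          · rw [hi, Fin.succ_last, hlast]
          · obtain ⟨j, hj⟩ := Fin.exists_castSucc_eq.2 hi
            have hnj : ¬ L j.succ := fun hh => h (hj ▸ hL j hh)
            have := hE j.succ
            simp only [hnj, if_false] at this
            rwa [← hj, Fin.succ_castSucc]
        simp only [hC, h, Matrix.of_apply, Fin.cons_succ, if_false, e1, e3, sub_self]
    rw [this]; simp

/-! ### Determinants of increments -/

/-- Cut the interval at an exceptional point and induct on the exceptional set. This is needed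
because powers of the truncated cosine may fail to be differentiable at the truncation points. -/
theorem le_of_deriv_nonneg_off_finset {f f' : ℝ → ℝ} (S : Finset ℝ) {a b : ℝ} (hab : a ≤ b)
    (hf : ContinuousOn f (Set.Icc a b))
    (hd : ∀ t ∈ Set.Ioo a b, t ∉ S → HasDerivAt f (f' t) t)
    (hn : ∀ t ∈ Set.Ioo a b, t ∉ S → 0 ≤ f' t) : f a ≤ f b := by
  induction S using Finset.strongInduction generalizing a b with
  | H S ih =>
    by_cases h : ∃ s ∈ S, s ∈ Set.Ioo a b
    · obtain ⟨s, hs, has, hsb⟩ := h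
      have key : ∀ c d : ℝ, c ≤ d → a ≤ c → d ≤ b → (∀ t ∈ Set.Ioo c d, t ≠ s) → f c ≤ f d := by
        intro c d hcd hac hdb hne
        refine ih (S.erase s) (Finset.erase_ssubset hs) hcd (hf.mono (Set.Icc_subset_Icc hac hdb))
          (fun t ht hts => hd t ?_ ?_) (fun t ht hts => hn t ?_ ?_)
        · exact Set.Ioo_subset_Ioo hac hdb ht
        · exact fun hh => hts (Finset.mem_erase.2 ⟨hne t ht, hh⟩)
        · exact Set.Ioo_subset_Ioo hac hdb ht
        · exact fun hh => hts (Finset.mem_erase.2 ⟨hne t ht, hh⟩)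
      exact (key a s has.le le_rfl hsb.le fun t ht => ht.2.ne).trans
        (key s b hsb.le has.le le_rfl fun t ht => ht.1.ne')
    · have h' : ∀ t ∈ Set.Ioo a b, t ∉ S := fun t ht hs => h ⟨t, hs, ht⟩
      refine monotoneOn_of_deriv_nonneg (convex_Icc a b) hf ?_ ?_ (Set.left_mem_Icc.2 hab)
        (Set.right_mem_Icc.2 hab) hab
      · rw [interior_Icc]
        exact fun t ht => (hd t ht (h' t ht)).differentiableAt.differentiableWithinAt
      · rw [interior_Icc]
        intro t ht
        rw [(hd t ht (h' t ht)).deriv]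
        exact hn t ht (h' t ht)

theorem det_updateRow_eq_sum {n : ℕ} (M : Matrix (Fin n) (Fin n) ℝ) (i : Fin n) (v : Fin n → ℝ) :
    (M.updateRow i v).det = ∑ k, v k * (M.updateRow i (Pi.single k 1)).det := by
  have : v = ∑ k, v k • (Pi.single k 1 : Fin n → ℝ) := by
    ext j; simp [Finset.sum_apply, Pi.single_apply]
  simp only [← Matrix.cramer_transpose_apply]
  conv_lhs => rw [this, map_sum, Finset.sum_apply]
  simp

theorem hasDerivAt_det_updateRow {n : ℕ} (M : Matrix (Fin n) (Fin n) ℝ) (i : Fin n)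
    {H : ℝ → Fin n → ℝ} {H' : Fin n → ℝ} {t : ℝ} (hH : ∀ k, HasDerivAt (fun s => H s k) (H' k) t) :
    HasDerivAt (fun s => (M.updateRow i (H s)).det) (M.updateRow i H').det t := by
  simp only [det_updateRow_eq_sum M i (H _), det_updateRow_eq_sum M i H']
  exact HasDerivAt.fun_sum fun k _ => (hH k).mul_const _

theorem continuousOn_det_updateRow {n : ℕ} (M : Matrix (Fin n) (Fin n) ℝ) (i : Fin n)
    {H : ℝ → Fin n → ℝ} {s : Set ℝ} (hH : ∀ k, ContinuousOn (fun t => H t k) s) :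
    ContinuousOn (fun t => (M.updateRow i (H t)).det) s := by
  simp only [det_updateRow_eq_sum M i (H _)]
  exact continuousOn_finsetSum _ fun k _ => (hH k).mul continuousOn_const

theorem det_updateRow_sub {n : ℕ} (M : Matrix (Fin n) (Fin n) ℝ) (i : Fin n) (u v : Fin n → ℝ) :
    (M.updateRow i (fun k => u k - v k)).det = (M.updateRow i u).det - (M.updateRow i v).det := by
  simp only [det_updateRow_eq_sum M i (fun k => u k - v k), det_updateRow_eq_sum M i u,
    det_updateRow_eq_sum M i v, ← Finset.sum_sub_distrib, sub_mul]

/-- A determinant of increments is non-negative if the determinants of derivatives are. -/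
theorem det_increments_nonneg {n : ℕ} (H H' : Fin n → ℝ → Fin n → ℝ) (l u : Fin n → ℝ)
    (S : Finset ℝ) (hlu : ∀ i, l i < u i)
    (hc : ∀ i k, ContinuousOn (fun t => H i t k) (Set.Icc (l i) (u i)))
    (hd : ∀ i k, ∀ t ∈ Set.Ioo (l i) (u i), t ∉ S → HasDerivAt (fun t => H i t k) (H' i t k) t)
    (hn : ∀ τ : Fin n → ℝ, (∀ i, τ i ∈ Set.Ioo (l i) (u i)) →
      0 ≤ (Matrix.of fun i k => H' i (τ i) k).det) :
    0 ≤ (Matrix.of fun i k => H i (u i) k - H i (l i) k).det := by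
  -- Derivative rows are replaced by increment rows one at a time: with the other rows fixed, the
  -- determinant is linear in row `i`, hence a function of one variable `t`.
  have key : ∀ T : Finset (Fin n), ∀ τ : Fin n → ℝ, (∀ i, τ i ∈ Set.Ioo (l i) (u i)) →
      0 ≤ (Matrix.of fun i k => if i ∈ T then H i (u i) k - H i (l i) k else H' i (τ i) k).det := by
    intro T
    induction T using Finset.induction_on with
    | empty => intro τ hτ; simpa using hn τ hτ
    | insert i T hi ih =>
      intro τ hτ
      set M := (Matrix.of fun j k => if j ∈ T then H j (u j) k - H j (l j) k else H' j (τ j) k)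
        with hM
      have e1 : (Matrix.of fun j k => if j ∈ insert i T then H j (u j) k - H j (l j) k
          else H' j (τ j) k) = M.updateRow i (fun k => H i (u i) k - H i (l i) k) := by
        ext j k
        by_cases hj : j = i
        · subst hj; simp
        · simp [hM, hj]
      rw [e1, det_updateRow_sub, sub_nonneg]
      refine le_of_deriv_nonneg_off_finset (f := fun t => (M.updateRow i (H i t)).det)
        (f' := fun t => (M.updateRow i (H' i t)).det) S (hlu i).le
        (continuousOn_det_updateRow M i (hc i))
        (fun t ht hts => hasDerivAt_det_updateRow M i fun k => hd i k t ht hts) ?_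
      intro t ht _
      convert ih (Function.update τ i t) ?_ using 2
      · ext j k
        by_cases hj : j = i
        · subst hj; simp [hi]
        · simp [hM, hj]
      · intro j
        by_cases hj : j = i
        · subst hj; simpa using ht
        · simpa [hj] using hτ j
  have := key Finset.univ (fun i => (l i + u i) / 2)
    (fun i => ⟨by linarith [hlu i], by linarith [hlu i]⟩)
  simpa using this

/-- Row-wise mean value theorem for a determinant of increments. -/
theorem exists_det_increments_eq {n : ℕ} (H H' : ℝ → Fin n → ℝ) (l u : Fin n → ℝ)
    (hlu : ∀ i, l i < u i)
    (hd : ∀ i k, ∀ t ∈ Set.Icc (l i) (u i), HasDerivAt (fun t => H t k) (H' t k) t) :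
    ∃ τ : Fin n → ℝ, (∀ i, τ i ∈ Set.Ioo (l i) (u i)) ∧
      (Matrix.of fun i k => H (u i) k - H (l i) k).det =
        (∏ i, (u i - l i)) * (Matrix.of fun i k => H' (τ i) k).det := by
  have key : ∀ T : Finset (Fin n), ∃ τ : Fin n → ℝ, (∀ i, τ i ∈ Set.Ioo (l i) (u i)) ∧
      (Matrix.of fun i k => H (u i) k - H (l i) k).det = (∏ i ∈ T, (u i - l i)) *
        (Matrix.of fun i k => if i ∈ T then H' (τ i) k else H (u i) k - H (l i) k).det := by
    intro T
    induction T using Finset.induction_on with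
    | empty =>
      -- The midpoints are placeholders, overwritten as rows are treated.
      exact ⟨fun i => (l i + u i) / 2, fun i => ⟨by linarith [hlu i], by linarith [hlu i]⟩, by simp⟩
    | insert i T hi ih =>
      obtain ⟨τ, hτ, e⟩ := ih
      set M := (Matrix.of fun j k => if j ∈ T then H' (τ j) k else H (u j) k - H (l j) k)
        with hM
      have e1 : M = M.updateRow i (fun k => H (u i) k - H (l i) k) := by
        ext j k
        by_cases hj : j = i
        · subst hj; simp [hM, hi]
        · simp [Matrix.updateRow_ne hj]
      have hder : ∀ t ∈ Set.Icc (l i) (u i), HasDerivAt (fun t => (M.updateRow i (H t)).det)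
          (M.updateRow i (H' t)).det t :=
        fun t ht => hasDerivAt_det_updateRow M i fun k => hd i k t ht
      obtain ⟨t, ht, e2⟩ := exists_hasDerivAt_eq_slope (fun t => (M.updateRow i (H t)).det)
        (fun t => (M.updateRow i (H' t)).det) (hlu i)
        (fun t ht => (hder t ht).continuousAt.continuousWithinAt)
        (fun t ht => hder t (Set.Ioo_subset_Icc_self ht))
      refine ⟨Function.update τ i t, ?_, ?_⟩
      · intro j
        by_cases hj : j = i
        · subst hj; simpa using ht
        · simpa [hj] using hτ j
      · have e3 : (Matrix.of fun j k => if j ∈ insert i T then H' (Function.update τ i t j) k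
            else H (u j) k - H (l j) k) = M.updateRow i (H' t) := by
          ext j k
          by_cases hj : j = i
          · subst hj; simp
          · simp [hM, hj]
        rw [e3, e2, e, e1, det_updateRow_sub, Finset.prod_insert hi]
        have : u i - l i ≠ 0 := by linarith [hlu i]
        field_simp
        congr 1
        simp
  obtain ⟨τ, hτ, e⟩ := key Finset.univ
  exact ⟨τ, hτ, by simpa using e⟩

theorem det_mul_row_mul_column {n : ℕ} (r c : Fin n → ℝ) (M : Fin n → Fin n → ℝ) :
    (Matrix.of fun i k => r i * c k * M i k).det =
      (∏ i, r i) * (∏ k, c k) * (Matrix.of fun i k => M i k).det := by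
  have : (Matrix.of fun i k => r i * c k * M i k) =
      Matrix.of fun i k => r i * (Matrix.of fun i k => c k * (Matrix.of fun i k => M i k) i k) i k := by
    ext i k; simp [mul_assoc]
  rw [this, Matrix.det_mul_column, Matrix.det_mul_row, mul_assoc]

theorem det_of_rev_rev {n : ℕ} (M : Fin n → Fin n → ℝ) :
    (Matrix.of fun i k : Fin n => M i.rev k.rev).det = (Matrix.of fun i k => M i k).det :=
  Matrix.det_submatrix_equiv_self Fin.revPerm (Matrix.of fun i k => M i k)

/-! ### The truncated cosine kernel -/

/-- The positive part of `cos t ^ α` on `(-π/2, π/2)`, extended by zero to the line. -/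
noncomputable def cosBump (α t : ℝ) : ℝ := if |t| < Real.pi / 2 then Real.cos t ^ α else 0

theorem cos_pos_of_abs_lt {t : ℝ} (h : |t| < Real.pi / 2) : 0 < Real.cos t :=
  Real.cos_pos_of_mem_Ioo (abs_lt.1 h)

theorem cosBump_of_abs_lt (α : ℝ) {t : ℝ} (h : |t| < Real.pi / 2) :
    cosBump α t = Real.cos t ^ α := if_pos h

theorem cosBump_of_le_abs (α : ℝ) {t : ℝ} (h : Real.pi / 2 ≤ |t|) : cosBump α t = 0 :=
  if_neg h.not_gt

theorem cosBump_nonneg (α t : ℝ) : 0 ≤ cosBump α t := by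
  unfold cosBump
  split_ifs with h
  · exact Real.rpow_nonneg (cos_pos_of_abs_lt h).le _
  · exact le_rfl

theorem continuous_cosBump {α : ℝ} (hα : 0 < α) : Continuous (cosBump α) := by
  have : cosBump α = fun t => Real.cos (max (-(Real.pi / 2)) (min (Real.pi / 2) t)) ^ α := by
    ext t
    have hpi := Real.pi_pos
    by_cases h : |t| < Real.pi / 2
    · rw [cosBump_of_abs_lt _ h, min_eq_right (abs_lt.1 h).2.le, max_eq_right (abs_lt.1 h).1.le]
    · rw [cosBump_of_le_abs _ (not_lt.1 h)]
      rcases le_abs.1 (not_lt.1 h) with h | h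
      · rw [min_eq_left h, max_eq_right (by linarith), Real.cos_pi_div_two, Real.zero_rpow hα.ne']
      · rw [min_eq_right (by linarith), max_eq_left (by linarith), Real.cos_neg,
          Real.cos_pi_div_two, Real.zero_rpow hα.ne']
  rw [this]
  exact (Real.continuous_cos.comp (by fun_prop)).rpow_const fun _ => Or.inr hα.le

/-- The Wronskian of the two shifted cosines is the constant sin(b - c), so `t` and `b` interact
only through the bump of exponent `α - 1`. The sign `s` is that of cos(t - c), which lets one
formula serve both sides of the zero of the denominator. -/
theorem hasDerivAt_cosBump_div {α s t b c : ℝ} (hs : s * s = 1) (hst : 0 < s * Real.cos (t - c))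
    (h : |t - b| ≠ Real.pi / 2) :
    HasDerivAt (fun x => s * (cosBump α (x - b) / |Real.cos (x - c)| ^ α))
      (α * Real.sin (b - c) * cosBump (α - 1) (t - b) / |Real.cos (t - c)| ^ (α + 1)) t := by
  have habs : ∀ x, 0 < s * Real.cos (x - c) → |Real.cos (x - c)| = s * Real.cos (x - c) := by
    intro x hx
    rw [← abs_of_pos hx, abs_mul]
    have : |s| = 1 := by
      have := abs_mul_abs_self s
      rw [hs] at this
      nlinarith [abs_nonneg s]
    rw [this, one_mul]
  rcases lt_or_gt_of_ne h with h | h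
  · have hq : 0 < Real.cos (t - b) := cos_pos_of_abs_lt h
    have e : (fun x => s * (cosBump α (x - b) / |Real.cos (x - c)| ^ α)) =ᶠ[nhds t]
        fun x => s * (Real.cos (x - b) / (s * Real.cos (x - c))) ^ α := by
      have o1 : ∀ᶠ x in nhds t, |x - b| < Real.pi / 2 :=
        (by fun_prop : Continuous fun x : ℝ => |x - b|).continuousAt.eventually_lt
          continuousAt_const h
      have o2 : ∀ᶠ x in nhds t, 0 < s * Real.cos (x - c) :=
        continuousAt_const.eventually_lt
          (by fun_prop : Continuous fun x : ℝ => s * Real.cos (x - c)).continuousAt hst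
      filter_upwards [o1, o2] with x h1 h2
      rw [cosBump_of_abs_lt _ h1, habs x h2, Real.div_rpow (cos_pos_of_abs_lt h1).le h2.le]
    refine HasDerivAt.congr_of_eventuallyEq ?_ e
    have d1 : HasDerivAt (fun x => Real.cos (x - b)) (-Real.sin (t - b)) t := by
      simpa using ((hasDerivAt_id t).sub_const b).cos
    have d2 : HasDerivAt (fun x => s * Real.cos (x - c)) (s * -Real.sin (t - c)) t := by
      simpa using (((hasDerivAt_id t).sub_const c).cos).const_mul s
    have d3 := ((d1.fun_div d2 hst.ne').rpow_const (p := α) (Or.inl (div_pos hq hst).ne')).const_mul s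
    refine d3.congr_deriv ?_
    rw [cosBump_of_abs_lt _ h, habs t hst, Real.div_rpow hq.le hst.le]
    set w := s * Real.cos (t - c) with hw
    have e1 : w ^ (α + 1) = w ^ (α - 1) * w ^ 2 := by
      rw [← Real.rpow_natCast, ← Real.rpow_add hst]; congr 1; push_cast; ring
    have e2 : Real.sin (b - c) = Real.sin (t - c) * Real.cos (t - b)
        - Real.cos (t - c) * Real.sin (t - b) := by
      rw [← Real.sin_sub]; congr 1; ring
    have e3 : s * (-Real.sin (t - b) * w - Real.cos (t - b) * (s * -Real.sin (t - c)))
        = Real.sin (b - c) := by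
      rw [hw, e2]; linear_combination (Real.sin (t - c) * Real.cos (t - b)
        - Real.cos (t - c) * Real.sin (t - b)) * hs
    have hw' := (Real.rpow_pos_of_pos hst (α - 1)).ne'
    have hw0 := hst.ne'
    rw [e1, ← e3]
    field_simp
  · have e : (fun x => s * (cosBump α (x - b) / |Real.cos (x - c)| ^ α)) =ᶠ[nhds t]
        fun _ => 0 := by
      have o1 : ∀ᶠ x in nhds t, Real.pi / 2 < |x - b| :=
        continuousAt_const.eventually_lt
          (by fun_prop : Continuous fun x : ℝ => |x - b|).continuousAt h
      filter_upwards [o1] with x h1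
      rw [cosBump_of_le_abs _ h1.le]; simp
    rw [cosBump_of_le_abs _ h.le]
    simpa using (hasDerivAt_const t (0 : ℝ)).congr_of_eventuallyEq e

/-- Reduction of the exponent and the order by one, for determinants of `cosBump`. -/
theorem det_cosBump_nonneg_of_pred {n : ℕ} {α : ℝ} (hα : 0 < α) (a b : Fin (n + 1) → ℝ)
    (ha : StrictMono a) (hb : StrictMono b) (hbπ : b (Fin.last n) - b 0 < Real.pi)
    (h0 : b 0 - Real.pi / 2 < a 0) (h0' : a 0 < b 0 + Real.pi / 2)
    (hl : a (Fin.last n) < b (Fin.last n) + Real.pi / 2) (hne : ∀ j, a j ≠ b 0 + Real.pi / 2)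
    (H : ∀ τ : Fin n → ℝ, StrictMono τ →
      ((∀ j, a j < b 0 + Real.pi / 2) → ∀ i, τ i < b 0 + Real.pi / 2) →
      0 ≤ (Matrix.of fun i k : Fin n => cosBump (α - 1) (τ i - b k.succ)).det) :
    0 ≤ (Matrix.of fun j k => cosBump α (a j - b k)).det := by
  classical
  have hpi := Real.pi_pos
  -- An additional node to the right of all `a j`, where every column vanishes: it supplies the zero
  -- row used by the last forward difference.
  set e := b (Fin.last n) + Real.pi / 2 with he
  set ae : Fin (n + 2) → ℝ := Fin.snoc a e with hae
  have ae_cast : ∀ j : Fin (n + 1), ae j.castSucc = a j := fun j => by simp [hae]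
  have ae_last : ae (Fin.last (n + 1)) = e := by simp [hae]
  have ae_mono : StrictMono ae := by
    refine Fin.strictMono_iff_lt_succ.2 fun j => ?_
    rw [ae_cast]
    refine Fin.lastCases ?_ (fun i => ?_) j
    · rw [Fin.succ_last, ae_last]; exact hl
    · rw [Fin.succ_castSucc, ae_cast]; exact ha i.castSucc_lt_succ
  set L : Fin (n + 1) → Prop := fun j => a j < b 0 + Real.pi / 2 with hL
  have ba : ∀ j, b 0 - Real.pi / 2 < a j := fun j => h0.trans_le (ha.monotone (Fin.zero_le j))
  have ale : ∀ j, a j < e := fun j => (ha.monotone (Fin.le_last j)).trans_lt hl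
  have cospos : ∀ t, b 0 - Real.pi / 2 < t → t < b 0 + Real.pi / 2 → 0 < Real.cos (t - b 0) :=
    fun t h1 h2 => Real.cos_pos_of_mem_Ioo ⟨by linarith, by linarith⟩
  have cosneg : ∀ t, b 0 + Real.pi / 2 < t → t ≤ e → Real.cos (t - b 0) < 0 :=
    fun t h1 h2 => Real.cos_neg_of_pi_div_two_lt_of_lt (by linarith) (by linarith)
  have cosne : ∀ j, Real.cos (a j - b 0) ≠ 0 := by
    intro j
    rcases lt_or_gt_of_ne (hne j) with h | h
    · exact (cospos _ (ba j) h).ne'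
    · exact (cosneg _ h (ale j).le).ne
  set E : Fin (n + 2) → Fin (n + 1) → ℝ :=
    fun j k => cosBump α (ae j - b k) / |Real.cos (ae j - b 0)| ^ α with hE
  have hdet : (Matrix.of fun j k => cosBump α (a j - b k)).det =
      (∏ j, |Real.cos (a j - b 0)| ^ α) * (∏ _k : Fin (n + 1), (1 : ℝ)) *
      (Matrix.of fun j k : Fin (n + 1) => E j.castSucc k).det := by
    rw [← det_mul_row_mul_column]
    congr 1; ext j k
    have := (Real.rpow_pos_of_pos (abs_pos.2 (cosne j)) α).ne'
    simp only [Matrix.of_apply, hE, ae_cast]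
    field_simp
  rw [hdet]
  refine mul_nonneg (by positivity) ?_
  rw [det_eq_det_row_differences E L h0' (fun i hi => (ha i.castSucc_lt_succ).trans hi)]
  rotate_left
  · intro j
    simp only [hE, ae_cast]
    by_cases h : L j
    · have hp := cospos _ (ba j) h
      have : |a j - b 0| < Real.pi / 2 := by
        have := ba j
        exact abs_lt.2 ⟨by linarith, by simp only [hL] at h; linarith⟩
      rw [cosBump_of_abs_lt _ this, abs_of_pos hp, if_pos h, div_self]
      exact (Real.rpow_pos_of_pos hp α).ne'
    · rw [if_neg h, cosBump_of_le_abs, zero_div]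
      exact le_abs.2 (Or.inl (by simp only [hL, not_lt] at h; linarith))
  · intro k
    simp only [hE, ae_last]
    rw [cosBump_of_le_abs, zero_div]
    have := hb.monotone (Fin.le_last k)
    exact le_abs.2 (Or.inl (by linarith))
  -- Each new row is an increment over [`l i`, `u i`], with sign -1 for forward differences. No
  -- interval meets the zero `b 0 + π/2` of the denominator.
  set s : Fin n → ℝ := fun i => if L i.succ then 1 else -1 with hs
  set l : Fin n → ℝ := fun i => if L i.succ then a i.castSucc else a i.succ with hl'
  set u : Fin n → ℝ := fun i => if L i.succ then a i.succ else ae i.succ.succ with hu'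
  have hss : ∀ i, s i * s i = 1 := by intro i; by_cases h : L i.succ <;> simp [hs, h]
  have hlu : ∀ i, l i < u i := by
    intro i
    by_cases h : L i.succ
    · simp only [hl', hu', h, if_true]; exact ha i.castSucc_lt_succ
    · simp only [hl', hu', h, if_false]; rw [← ae_cast]; exact ae_mono i.succ.castSucc_lt_succ
  have hpos : ∀ i, ∀ t ∈ Set.Icc (l i) (u i), 0 < s i * Real.cos (t - b 0) := by
    intro i t ht
    by_cases h : L i.succ
    · simp only [hl', hu', hs, h, if_true] at ht ⊢
      rw [one_mul]
      exact cospos t ((ba _).trans_le ht.1) (ht.2.trans_lt h)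
    · simp only [hl', hu', hs, h, if_false] at ht ⊢
      have h2 : b 0 + Real.pi / 2 < a i.succ := lt_of_le_of_ne (not_lt.1 h) (hne _).symm
      have h3 : t ≤ e := ht.2.trans (ae_last ▸ ae_mono.monotone (Fin.le_last _))
      have := cosneg t (h2.trans_le ht.1) h3
      linarith
  have key := det_increments_nonneg
    (fun i t (k : Fin n) => s i * (cosBump α (t - b k.succ) / |Real.cos (t - b 0)| ^ α))
    (fun _ t k => α * Real.sin (b k.succ - b 0) * cosBump (α - 1) (t - b k.succ) /
      |Real.cos (t - b 0)| ^ (α + 1)) l u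
    (Finset.univ.image (fun k => b k - Real.pi / 2) ∪ Finset.univ.image (fun k => b k + Real.pi / 2))
    hlu ?_ ?_ ?_
  · refine key.trans_eq (congrArg (fun M => (Matrix.of M).det) ?_)
    funext i k
    by_cases h : L i.succ
    · simp only [hl', hu', hs, h, if_true, hE, ae_cast]; ring
    · simp only [hl', hu', hs, h, if_false, hE, ae_cast]; ring
  · intro i k t ht
    have hp := hpos i t ht
    have hc0 : Real.cos (t - b 0) ≠ 0 := fun h => by rw [h] at hp; simp at hp
    have c1 : ContinuousAt (fun t => cosBump α (t - b k.succ)) t :=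
      ((continuous_cosBump hα).comp (by fun_prop : Continuous fun t : ℝ => t - b k.succ)).continuousAt
    have c2 : ContinuousAt (fun t => |Real.cos (t - b 0)| ^ α) t :=
      ContinuousAt.rpow_const (by fun_prop) (Or.inr hα.le)
    exact (continuousAt_const.mul
      (c1.div c2 (Real.rpow_pos_of_pos (abs_pos.2 hc0) α).ne')).continuousWithinAt
  · intro i k t ht htS
    refine hasDerivAt_cosBump_div (hss i) (hpos i t (Set.Ioo_subset_Icc_self ht)) fun h => htS ?_
    simp only [Finset.mem_union, Finset.mem_image, Finset.mem_univ, true_and]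
    rcases eq_or_eq_neg_of_abs_eq h with h | h
    · exact Or.inr ⟨k.succ, by linarith⟩
    · exact Or.inl ⟨k.succ, by linarith⟩
  · intro τ hτ
    -- The intervals are consecutive gaps between nodes, omitting the gap that contains `b 0 + π/2`,
    -- so they are ordered and do not overlap.
    have hτm : StrictMono τ := by
      intro i j hij
      have h1 := (hτ i).2
      have h2 := (hτ j).1
      suffices u i ≤ l j by linarith
      by_cases hi : L i.succ
      · have : a i.succ ≤ a j.castSucc := ha.monotone (Fin.succ_le_castSucc_iff.2 hij)
        have h3 := ha j.castSucc_lt_succ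
        by_cases hj : L j.succ
        · simpa [hl', hu', hi, hj] using this
        · simp only [hl', hu', hi, hj, if_true, if_false]; linarith
      · have hj : ¬ L j.succ := fun h => hi ((ha (Fin.succ_lt_succ_iff.2 hij)).trans h)
        simp only [hl', hu', hi, hj, if_false]
        rw [← ae_cast]
        exact ae_mono.monotone (Fin.succ_le_castSucc_iff.2 (Fin.succ_lt_succ_iff.2 hij))
    have hnn := H τ hτm (by
      intro h i
      have h1 := (hτ i).2
      simp only [hu', hL, h, if_true] at h1
      exact h1.trans (h _))
    have hfac : (Matrix.of fun i k : Fin n => α * Real.sin (b k.succ - b 0) *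
        cosBump (α - 1) (τ i - b k.succ) / |Real.cos (τ i - b 0)| ^ (α + 1)) =
        Matrix.of fun i k : Fin n => (α / |Real.cos (τ i - b 0)| ^ (α + 1)) *
          Real.sin (b k.succ - b 0) * cosBump (α - 1) (τ i - b k.succ) := by
      ext i k; simp only [Matrix.of_apply]; ring
    rw [hfac, det_mul_row_mul_column]
    refine mul_nonneg (mul_nonneg (Finset.prod_nonneg fun i _ => ?_)
      (Finset.prod_nonneg fun k _ => ?_)) hnn
    · positivity
    · have h1 := hb (Fin.succ_pos k)
      have h2 := hb.monotone (Fin.le_last k.succ)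
      exact Real.sin_nonneg_of_nonneg_of_le_pi (by linarith) (by linarith)

open Filter Topology in
/-- `cosBump α (a - b)` is totally non-negative of order `n` for `α > n - 2`. -/
theorem det_cosBump_nonneg (n : ℕ) (α : ℝ) (hα : (n : ℝ) - 2 < α) (a b : Fin n → ℝ)
    (ha : StrictMono a) (hb : StrictMono b) (hbπ : ∀ j k, b j - b k < Real.pi) :
    0 ≤ (Matrix.of fun j k => cosBump α (a j - b k)).det := by
  induction n generalizing α with
  | zero => simp
  | succ n ih =>
    rcases Nat.eq_zero_or_pos n with rfl | hn
    · have := Matrix.det_fin_one (Matrix.of fun j k : Fin 1 => cosBump α (a j - b k))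
      exact (cosBump_nonneg α (a 0 - b 0)).trans_eq this.symm
    have hn' : (1 : ℝ) ≤ n := by exact_mod_cast hn
    push_cast at hα
    have hα0 : 0 < α := by linarith
    -- If the first column or an extreme row is entirely truncated the determinant is zero;
    -- otherwise the reduction applies. Nodes at `b 0 + π/2` are treated afterwards by a small right
    -- shift of all `a j`.
    have generic : ∀ a : Fin (n + 1) → ℝ, StrictMono a → (∀ j, a j ≠ b 0 + Real.pi / 2) →
        0 ≤ (Matrix.of fun j k => cosBump α (a j - b k)).det := by
      intro a ha hne
      by_cases h1 : b 0 - Real.pi / 2 < a 0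
      swap
      · refine (Matrix.det_eq_zero_of_row_eq_zero 0 fun k => ?_).ge
        have := hb.monotone (Fin.zero_le k)
        exact cosBump_of_le_abs _ (le_abs.2 (Or.inr (by linarith)))
      by_cases h2 : a 0 < b 0 + Real.pi / 2
      swap
      · refine (Matrix.det_eq_zero_of_column_eq_zero 0 fun j => ?_).ge
        have := ha.monotone (Fin.zero_le j)
        exact cosBump_of_le_abs _ (le_abs.2 (Or.inl (by linarith)))
      by_cases h3 : a (Fin.last n) < b (Fin.last n) + Real.pi / 2
      swap
      · refine (Matrix.det_eq_zero_of_row_eq_zero (Fin.last n) fun k => ?_).ge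
        have := hb.monotone (Fin.le_last k)
        exact cosBump_of_le_abs _ (le_abs.2 (Or.inl (by linarith)))
      exact det_cosBump_nonneg_of_pred hα0 a b ha hb (hbπ _ _) h1 h2 h3 hne fun τ hτ _ =>
        ih (α - 1) (by linarith) τ (fun k => b k.succ) hτ
          (hb.comp (Fin.strictMono_succ)) fun j k => hbπ _ _
    have hcont : Continuous fun ε : ℝ =>
        (Matrix.of fun j k => cosBump α (a j + ε - b k)).det :=
      Continuous.matrix_det (continuous_matrix fun j k =>
        (continuous_cosBump hα0).comp (by fun_prop : Continuous fun ε : ℝ => a j + ε - b k))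
    have hlim : Tendsto (fun ε : ℝ => (Matrix.of fun j k => cosBump α (a j + ε - b k)).det)
        (𝓝[>] 0) (𝓝 (Matrix.of fun j k => cosBump α (a j - b k)).det) := by
      have := (hcont.tendsto 0).mono_left (nhdsWithin_le_nhds (s := Set.Ioi 0))
      simpa using this
    have hev : ∀ j, ∀ᶠ ε : ℝ in 𝓝[>] 0, a j + ε ≠ b 0 + Real.pi / 2 := by
      intro j
      by_cases h : a j = b 0 + Real.pi / 2
      · filter_upwards [self_mem_nhdsWithin] with ε hε
        rw [h]
        exact ne_of_gt (lt_add_of_pos_right _ hε)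
      · have : ContinuousAt (fun ε : ℝ => a j + ε) 0 := by fun_prop
        exact (this.eventually_ne (by simpa using h)).filter_mono nhdsWithin_le_nhds
    refine ge_of_tendsto hlim ?_
    filter_upwards [eventually_all.2 hev] with ε hε
    exact generic (fun j => a j + ε) (fun i j hij => by simpa using ha hij) hε

/-- With truncation on one side only, natural exponents give total non-negativity. -/
theorem det_cosBump_natCast_nonneg (m n : ℕ) (a b : Fin n → ℝ)
    (ha : StrictMono a) (hb : StrictMono b) (hbπ : ∀ j k, b j - b k < Real.pi)
    (hab : ∀ j k, a j < b k + Real.pi / 2) :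
    0 ≤ (Matrix.of fun j k => cosBump m (a j - b k)).det := by
  induction m generalizing n with
  | zero =>
    induction n with
    | zero => simp
    | succ n ih =>
      by_cases h1 : b 0 - Real.pi / 2 < a 0
      swap
      · refine (Matrix.det_eq_zero_of_row_eq_zero 0 fun k => ?_).ge
        have := hb.monotone (Fin.zero_le k)
        exact cosBump_of_le_abs _ (le_abs.2 (Or.inr (by linarith)))
      have one : ∀ j k, b k - Real.pi / 2 < a j → cosBump ((0 : ℕ) : ℝ) (a j - b k) = 1 := by
        intro j k h
        have := hab j k
        rw [cosBump_of_abs_lt _ (abs_lt.2 ⟨by linarith, by linarith⟩)]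
        simp
      -- Exponent 0: the first row is 1, …, 1, 0, …, 0. Two leading ones force two equal columns; a
      -- single one allows expansion along the row.
      by_cases h2 : ∃ k : Fin n, b k.succ - Real.pi / 2 < a 0
      · obtain ⟨k, hk⟩ := h2
        refine (Matrix.det_zero_of_column_eq (Fin.succ_ne_zero k).symm fun j => ?_).ge
        have := ha.monotone (Fin.zero_le j)
        simp only [Matrix.of_apply]
        rw [one j 0 (by linarith), one j k.succ (by linarith)]
      · push Not at h2
        rw [Matrix.det_succ_row_zero, Fin.sum_univ_succ, Finset.sum_eq_zero]
        · simp only [Matrix.of_apply, one 0 0 h1, Fin.val_zero, pow_zero, one_mul, add_zero]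
          exact ih (fun j => a j.succ) (fun k => b k.succ) (ha.comp Fin.strictMono_succ)
            (hb.comp Fin.strictMono_succ) (fun j k => hbπ _ _) (fun j k => hab _ _)
        · intro k _
          have : cosBump ((0 : ℕ) : ℝ) (a 0 - b k.succ) = 0 :=
            cosBump_of_le_abs _ (le_abs.2 (Or.inr (by linarith [h2 k])))
          simp only [Matrix.of_apply, this, mul_zero, zero_mul]
  | succ m ih =>
    rcases n with _ | n
    · simp
    by_cases h1 : b 0 - Real.pi / 2 < a 0
    swap
    · refine (Matrix.det_eq_zero_of_row_eq_zero 0 fun k => ?_).ge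
      have := hb.monotone (Fin.zero_le k)
      exact cosBump_of_le_abs _ (le_abs.2 (Or.inr (by linarith)))
    refine det_cosBump_nonneg_of_pred (by positivity) a b ha hb (hbπ _ _) h1 (hab _ _) (hab _ _)
      (fun j => (hab j 0).ne) fun τ hτ hlt => ?_
    have hcast : ((m + 1 : ℕ) : ℝ) - 1 = m := by push_cast; ring
    rw [hcast]
    refine ih n τ (fun k => b k.succ) hτ (hb.comp Fin.strictMono_succ) (fun j k => hbπ _ _) ?_
    intro j k
    have := hb (Fin.succ_pos k)
    linarith [hlt (fun j => hab j 0) j]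

/-! ### From the kernel to the truncated cosine -/

theorem jksPow_of_pos (α : ℝ) {x y : ℝ} (h : 0 < 1 + x * y) :
    jksPow α x y = (1 + x * y) ^ α := by
  simp [jksPow, zeroPow, jksKernel, max_eq_left h.le, h.ne']

theorem jksPow_of_nonpos (α : ℝ) {x y : ℝ} (h : 1 + x * y ≤ 0) : jksPow α x y = 0 := by
  simp [jksPow, zeroPow, jksKernel, max_eq_right h]

theorem jksPow_comm (α x y : ℝ) : jksPow α x y = jksPow α y x := by
  simp [jksPow, jksKernel, mul_comm]

theorem jksPow_neg_neg (α x y : ℝ) : jksPow α (-x) (-y) = jksPow α x y := by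
  simp [jksPow, jksKernel]

/-- Two arctangents differ by less than π, so the cosine of the difference is positive exactly when
the difference is below π/2 in absolute value; the two truncations therefore agree. -/
theorem jksPow_eq_cosBump (α x y : ℝ) :
    jksPow α x y = Real.cos (Real.arctan x) ^ (-α) * Real.cos (Real.arctan y) ^ (-α) *
      cosBump α (Real.arctan x - Real.arctan y) := by
  have hx := Real.cos_arctan_pos x
  have hy := Real.cos_arctan_pos y
  have hc : Real.cos (Real.arctan x - Real.arctan y) =
      Real.cos (Real.arctan x) * Real.cos (Real.arctan y) * (1 + x * y) := by
    have e1 := Real.tan_mul_cos hx.ne'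
    have e2 := Real.tan_mul_cos hy.ne'
    rw [Real.tan_arctan] at e1 e2
    rw [Real.cos_sub, ← e1, ← e2]; ring
  rcases lt_or_ge 0 (1 + x * y) with h | h
  · have habs : |Real.arctan x - Real.arctan y| < Real.pi / 2 := by
      by_contra hcon
      have hle : |Real.arctan x - Real.arctan y| ≤ Real.pi + Real.pi / 2 := by
        have := Real.arctan_lt_pi_div_two x
        have := Real.arctan_lt_pi_div_two y
        have := Real.neg_pi_div_two_lt_arctan x
        have := Real.neg_pi_div_two_lt_arctan y
        exact abs_le.2 ⟨by linarith, by linarith⟩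
      have := Real.cos_nonpos_of_pi_div_two_le_of_le (not_lt.1 hcon) hle
      rw [Real.cos_abs, hc] at this
      have : 0 < Real.cos (Real.arctan x) * Real.cos (Real.arctan y) * (1 + x * y) := by positivity
      linarith
    rw [jksPow_of_pos _ h, cosBump_of_abs_lt _ habs, hc, Real.mul_rpow (by positivity) h.le,
      Real.mul_rpow hx.le hy.le, Real.rpow_neg hx.le, Real.rpow_neg hy.le]
    have h1 := (Real.rpow_pos_of_pos hx α).ne'
    have h2 := (Real.rpow_pos_of_pos hy α).ne'
    field_simp
  · rw [jksPow_of_nonpos _ h, cosBump_of_le_abs, mul_zero]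
    by_contra hcon
    have := cos_pos_of_abs_lt (not_le.1 hcon)
    rw [hc] at this
    have := mul_nonpos_of_nonneg_of_nonpos (mul_pos hx hy).le h
    linarith

theorem det_jksPow_nonneg_of_det_cosBump_nonneg {n : ℕ} {α : ℝ} {x y : Fin n → ℝ}
    (h : 0 ≤ (Matrix.of fun j k => cosBump α (Real.arctan (x j) - Real.arctan (y k))).det) :
    0 ≤ (Matrix.of fun j k => jksPow α (x j) (y k)).det := by
  simp only [jksPow_eq_cosBump, det_mul_row_mul_column]
  refine mul_nonneg (mul_nonneg ?_ ?_) h <;>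
    exact Finset.prod_nonneg fun _ _ => Real.rpow_nonneg (Real.cos_arctan_pos _).le _

theorem arctan_sub_arctan_lt_pi (x y : ℝ) : Real.arctan x - Real.arctan y < Real.pi := by
  have := Real.arctan_lt_pi_div_two x
  have := Real.neg_pi_div_two_lt_arctan y
  linarith

-- The endpoint is the limit from larger exponents. Since 0^0 = 0, truncated entries stay zero for
-- every exponent and each entry is continuous in it.
open Filter Topology in
theorem det_jksPow_nonneg {n : ℕ} {α : ℝ} (hα : (n : ℝ) - 2 ≤ α) {x y : Fin n → ℝ}
    (hx : StrictMono x) (hy : StrictMono y) :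
    0 ≤ (Matrix.of fun j k => jksPow α (x j) (y k)).det := by
  have hlim : Tendsto (fun β : ℝ => (Matrix.of fun j k => jksPow β (x j) (y k)).det)
      (𝓝[>] α) (𝓝 (Matrix.of fun j k => jksPow α (x j) (y k)).det) := by
    refine Tendsto.mono_left ?_ nhdsWithin_le_nhds
    refine ContinuousAt.tendsto (f := fun β : ℝ => (Matrix.of fun j k => jksPow β (x j) (y k)).det) ?_
    refine Continuous.continuousAt (Continuous.matrix_det (continuous_matrix fun j k => ?_))
    simp only [Matrix.of_apply]
    rcases lt_or_ge 0 (1 + x j * y k) with h | h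
    · simp only [jksPow_of_pos _ h]
      exact Real.continuous_const_rpow h.ne'
    · simp only [jksPow_of_nonpos _ h]
      exact continuous_const
  refine ge_of_tendsto hlim ?_
  filter_upwards [self_mem_nhdsWithin] with β hβ
  exact det_jksPow_nonneg_of_det_cosBump_nonneg <|
    det_cosBump_nonneg n β (hα.trans_lt hβ) _ _ (Real.arctan_strictMono.comp hx)
      (Real.arctan_strictMono.comp hy) fun j k => arctan_sub_arctan_lt_pi _ _

/-- For y ≥ 0, arctan x < π/2 ≤ arctan y + π/2, so truncation occurs on one side only. -/
theorem det_jksPow_natCast_nonneg_of_nonneg (m : ℕ) {n : ℕ} {x y : Fin n → ℝ}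
    (hx : StrictMono x) (hy : StrictMono y) (h : ∀ k, 0 ≤ y k) :
    0 ≤ (Matrix.of fun j k => jksPow m (x j) (y k)).det := by
  refine det_jksPow_nonneg_of_det_cosBump_nonneg <| det_cosBump_natCast_nonneg m n _ _
    (Real.arctan_strictMono.comp hx) (Real.arctan_strictMono.comp hy)
    (fun j k => arctan_sub_arctan_lt_pi _ _) fun j k => ?_
  have h1 := Real.arctan_lt_pi_div_two (x j)
  have h2 := Real.arctan_nonneg.2 (h k)
  linarith

theorem det_jksPow_natCast_nonneg (m : ℕ) {n : ℕ} {x y : Fin n → ℝ}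
    (hx : StrictMono x) (hy : StrictMono y) (h : (∀ k, 0 ≤ y k) ∨ ∀ k, y k ≤ 0) :
    0 ≤ (Matrix.of fun j k => jksPow m (x j) (y k)).det := by
  rcases h with h | h
  · exact det_jksPow_natCast_nonneg_of_nonneg m hx hy h
  · have := det_jksPow_natCast_nonneg_of_nonneg m (x := fun j => -x j.rev) (y := fun j => -y j.rev)
      (fun i j hij => neg_lt_neg (hx (Fin.rev_lt_rev.2 hij)))
      (fun i j hij => neg_lt_neg (hy (Fin.rev_lt_rev.2 hij))) fun k => by simpa using h _
    simp only [jksPow_neg_neg] at this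
    rwa [det_of_rev_rev fun j k => jksPow m (x j) (y k)] at this

theorem det_jksPow_swap {n : ℕ} (α : ℝ) (x y : Fin n → ℝ) :
    (Matrix.of fun j k => jksPow α (x j) (y k)).det =
      (Matrix.of fun j k => jksPow α (y j) (x k)).det := by
  rw [← Matrix.det_transpose]
  congr 1; ext j k
  exact jksPow_comm _ _ _

/-! ### Matrices with positive entries -/

/-- Reduction of the exponent and the order by one, for determinants of powers of `1 + x y`. -/
theorem exists_det_one_add_mul_rpow_eq {n : ℕ} (α : ℝ) {x y : Fin (n + 1) → ℝ}
    (hx : StrictMono x) (hy : StrictMono y) (hpos : ∀ j k, 0 < 1 + x j * y k) :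
    ∃ c > 0, ∃ t : Fin n → ℝ, StrictMono t ∧ (∀ j (k : Fin n), 0 < 1 + t j * y k.succ) ∧
      (Matrix.of fun j k => (1 + x j * y k) ^ α).det =
        c * α ^ n * (Matrix.of fun j k : Fin n => (1 + t j * y k.succ) ^ (α - 1)).det := by
  -- 1 + ty is affine in `t`, so positivity at two nodes persists between them.
  have hpos' : ∀ (i : Fin n) (k), ∀ t ∈ Set.Icc (x i.castSucc) (x i.succ), 0 < 1 + t * y k := by
    intro i k t ht
    rcases le_total 0 (y k) with h | h
    · exact (hpos i.castSucc k).trans_le (by nlinarith [ht.1])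
    · exact (hpos i.succ k).trans_le (by nlinarith [ht.2])
  have hdet : (Matrix.of fun j k => (1 + x j * y k) ^ α).det =
      (∏ j, (1 + x j * y 0) ^ α) * (∏ _k : Fin (n + 1), (1 : ℝ)) *
        (Matrix.of fun j k => ((1 + x j * y k) / (1 + x j * y 0)) ^ α).det := by
    rw [← det_mul_row_mul_column]
    congr 1; ext j k
    have := (Real.rpow_pos_of_pos (hpos j 0) α).ne'
    simp only [Matrix.of_apply]
    rw [Real.div_rpow (hpos j k).le (hpos j 0).le]
    field_simp
  -- Nothing is truncated, so all differences are backward and the appended zero row is only a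
  -- formality.
  set E : Fin (n + 2) → Fin (n + 1) → ℝ :=
    Fin.snoc (α := fun _ => Fin (n + 1) → ℝ)
      (fun j k => ((1 + x j * y k) / (1 + x j * y 0)) ^ α) 0 with hE
  have E_cast : ∀ j : Fin (n + 1), E j.castSucc =
      fun k => ((1 + x j * y k) / (1 + x j * y 0)) ^ α := fun j => by simp [hE]
  have hdiff := det_eq_det_row_differences E (fun _ => True) trivial (fun _ => id)
    (fun j => by simp [E_cast, div_self (hpos j 0).ne']) (fun k => by simp [hE])
  simp only [E_cast, if_true] at hdiff
  obtain ⟨t, ht, hmv⟩ := exists_det_increments_eq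
    (fun t (k : Fin n) => ((1 + t * y k.succ) / (1 + t * y 0)) ^ α)
    (fun t k => α / (1 + t * y 0) ^ (α + 1) * (y k.succ - y 0) * (1 + t * y k.succ) ^ (α - 1))
    (fun i => x i.castSucc) (fun i => x i.succ) (fun i => hx i.castSucc_lt_succ) (by
      intro i k t ht
      have hu := hpos' i k.succ t ht
      have hv := hpos' i 0 t ht
      have d1 : HasDerivAt (fun t => 1 + t * y k.succ) (y k.succ) t := by
        simpa using ((hasDerivAt_id t).mul_const (y k.succ)).const_add 1
      have d2 : HasDerivAt (fun t => 1 + t * y 0) (y 0) t := by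
        simpa using ((hasDerivAt_id t).mul_const (y 0)).const_add 1
      refine ((d1.fun_div d2 hv.ne').rpow_const (p := α) (Or.inl (div_pos hu hv).ne')).congr_deriv ?_
      have e1 : (1 + t * y 0) ^ (α + 1) = (1 + t * y 0) ^ (α - 1) * (1 + t * y 0) ^ 2 := by
        rw [← Real.rpow_natCast, ← Real.rpow_add hv]; congr 1; push_cast; ring
      have hv' := (Real.rpow_pos_of_pos hv (α - 1)).ne'
      rw [Real.div_rpow hu.le hv.le, e1]
      have hv0 := hv.ne'
      field_simp
      ring)
  have hIcc := fun i => Set.Ioo_subset_Icc_self (ht i)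
  rw [det_mul_row_mul_column] at hmv
  refine ⟨(∏ j, (1 + x j * y 0) ^ α) * (∏ i : Fin n, (x i.succ - x i.castSucc)) *
    (∏ i, (1 / (1 + t i * y 0) ^ (α + 1))) * ∏ k : Fin n, (y k.succ - y 0), ?_, t, ?_, ?_, ?_⟩
  · refine mul_pos (mul_pos (mul_pos ?_ ?_) ?_) ?_ <;> refine Finset.prod_pos fun i _ => ?_
    · exact Real.rpow_pos_of_pos (hpos _ _) _
    · exact sub_pos.2 (hx i.castSucc_lt_succ)
    · exact one_div_pos.2 (Real.rpow_pos_of_pos (hpos' i 0 _ (hIcc i)) _)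
    · exact sub_pos.2 (hy i.succ_pos)
  · intro i j hij
    exact ((ht i).2.trans_le (hx.monotone (Fin.succ_le_castSucc_iff.2 hij))).trans (ht j).1
  · exact fun j k => hpos' j _ _ (hIcc j)
  · rw [hdet, hdiff, hmv]
    have : ∏ i, α / (1 + t i * y 0) ^ (α + 1) =
        α ^ n * ∏ i, (1 / (1 + t i * y 0) ^ (α + 1)) := by
      simp only [div_eq_mul_one_div α, Finset.prod_mul_distrib, Finset.prod_const,
        Finset.card_univ, Fintype.card_fin]
    rw [this]
    simp only [Finset.prod_const_one]
    ring

theorem det_one_add_mul_rpow_pos (n : ℕ) {α : ℝ} (hα : (n : ℝ) - 2 < α) {x y : Fin n → ℝ}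
    (hx : StrictMono x) (hy : StrictMono y) (hpos : ∀ j k, 0 < 1 + x j * y k) :
    0 < (Matrix.of fun j k => (1 + x j * y k) ^ α).det := by
  induction n generalizing α with
  | zero => simp
  | succ n ih =>
    obtain ⟨c, hc, t, ht, htpos, e⟩ := exists_det_one_add_mul_rpow_eq α hx hy hpos
    push_cast at hα
    rw [e]
    refine mul_pos (mul_pos hc ?_) (ih (by linarith) ht (hy.comp Fin.strictMono_succ) htpos)
    rcases Nat.eq_zero_or_pos n with rfl | hn
    · simp
    · have : (1 : ℝ) ≤ n := by exact_mod_cast hn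
      exact pow_pos (by linarith) n

/-- After `m` reductions the order is 3 and the exponent lies in (0, 1). Two more contribute α^2 and
α - 1 up to positive factors, and α - 1 is the only negative factor. -/
theorem det_one_add_mul_rpow_neg (m : ℕ) {α : ℝ} (hα : (m : ℝ) < α) (hα' : α < m + 1)
    {x y : Fin (m + 3) → ℝ} (hx : StrictMono x) (hy : StrictMono y)
    (hpos : ∀ j k, 0 < 1 + x j * y k) :
    (Matrix.of fun j k => (1 + x j * y k) ^ α).det < 0 := by
  induction m generalizing α with
  | zero =>
    obtain ⟨c, hc, t, ht, htpos, e⟩ := exists_det_one_add_mul_rpow_eq α hx hy hpos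
    obtain ⟨d, hd, u, -, hupos, e'⟩ :=
      exists_det_one_add_mul_rpow_eq (α - 1) ht (hy.comp Fin.strictMono_succ) htpos
    simp only [Function.comp] at e'
    push_cast at hα hα'
    rw [e, e', Matrix.det_unique]
    have h1 := Real.rpow_pos_of_pos (hupos default default) (α - 1 - 1)
    refine mul_neg_of_pos_of_neg (mul_pos hc (pow_pos hα _)) (mul_neg_of_neg_of_pos ?_ h1)
    exact mul_neg_of_pos_of_neg hd (by simp; linarith)
  | succ m ih =>
    obtain ⟨c, hc, t, ht, htpos, e⟩ := exists_det_one_add_mul_rpow_eq α hx hy hpos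
    push_cast at hα hα'
    rw [e]
    have h0 : 0 < α := by have := m.cast_nonneg (α := ℝ); linarith
    exact mul_neg_of_pos_of_neg (mul_pos hc (pow_pos h0 _))
      (ih (by linarith) (by linarith) ht (hy.comp Fin.strictMono_succ) htpos)

/-- The exponent reaches 0 while the order is still at least 2, where the reduction factor is a
positive power of 0. -/
theorem det_one_add_mul_natCast_rpow_eq_zero (m : ℕ) {n : ℕ} (hmn : m + 2 ≤ n) {x y : Fin n → ℝ}
    (hx : StrictMono x) (hy : StrictMono y) (hpos : ∀ j k, 0 < 1 + x j * y k) :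
    (Matrix.of fun j k => (1 + x j * y k) ^ (m : ℝ)).det = 0 := by
  induction m generalizing n with
  | zero =>
    obtain ⟨n, rfl⟩ : ∃ k, n = k + 2 := ⟨n - 2, by omega⟩
    obtain ⟨c, -, t, -, -, e⟩ := exists_det_one_add_mul_rpow_eq ((0 : ℕ) : ℝ) hx hy hpos
    rw [e]; simp
  | succ m ih =>
    obtain ⟨n, rfl⟩ : ∃ k, n = k + 1 := ⟨n - 1, by omega⟩
    obtain ⟨c, -, t, ht, htpos, e⟩ := exists_det_one_add_mul_rpow_eq ((m + 1 : ℕ) : ℝ) hx hy hpos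
    have hcast : ((m + 1 : ℕ) : ℝ) - 1 = m := by push_cast; ring
    have h0 : (Matrix.of fun j k : Fin n => (1 + t j * y k.succ) ^ (m : ℝ)).det = 0 :=
      ih (by omega) ht (hy.comp Fin.strictMono_succ) htpos
    rw [e, hcast, h0, mul_zero]

/-- The leading minor of order ⌊α⌋ + 3 ≤ p is already negative. -/
theorem not_isTNOrder_of_one_add_mul_pos {p : ℕ} {α : ℝ} (hα0 : 0 < α) (hα : α < (p : ℝ) - 2)
    (hint : ∀ n : ℕ, α ≠ n) {x y : Fin p → ℝ} (hx : StrictMono x) (hy : StrictMono y)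
    (hpos : ∀ j k, 0 < 1 + x j * y k) :
    ¬ IsTNOrder p (fun j k : Fin p => jksPow α (x j) (y k)) := by
  intro h
  have h1 : (⌊α⌋₊ : ℝ) < α := lt_of_le_of_ne (Nat.floor_le hα0.le) (hint _).symm
  have h2 := Nat.lt_floor_add_one α
  have hp : ⌊α⌋₊ + 3 ≤ p := by
    have : (⌊α⌋₊ : ℝ) + 2 < p := by linarith
    have : ⌊α⌋₊ + 2 < p := by exact_mod_cast this
    omega
  have hmono := Fin.strictMono_castLE hp
  have hneg := det_one_add_mul_rpow_neg ⌊α⌋₊ h1 h2 (hx.comp hmono) (hy.comp hmono)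
    fun j k => hpos _ _
  have hnn := h (⌊α⌋₊ + 3) (by omega) hp _ hmono _ hmono
  simp only [jksPow_of_pos _ (hpos _ _)] at hnn
  exact hneg.not_ge hnn

theorem exists_strictMono_one_add_mul_pos {I : Set ℝ} (hI : I.OrdConnected) (hI' : I.Nontrivial)
    (p : ℕ) : ∃ x y : Fin p → ℝ, StrictMono x ∧ StrictMono y ∧ (∀ j, x j ∈ I) ∧
      ∀ j k, 0 < 1 + x j * y k := by
  obtain ⟨u, hu, v, hv, huv⟩ := hI'.exists_lt
  rcases Nat.eq_zero_or_pos p with rfl | hp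
  · exact ⟨fun _ => 0, fun _ => 0, fun i => i.elim0, fun i => i.elim0, fun i => i.elim0,
      fun i => i.elim0⟩
  have hp' : (0 : ℝ) < p := by exact_mod_cast hp
  have hmono : ∀ c : ℝ, 0 < c → StrictMono fun j : Fin p => c * ((j : ℕ) / (p : ℝ)) :=
    fun c hc i j hij => mul_lt_mul_of_pos_left
      (div_lt_div_of_pos_right (by exact_mod_cast hij) hp') hc
  have hfrac : ∀ j : Fin p, 0 ≤ ((j : ℕ) : ℝ) / p ∧ ((j : ℕ) : ℝ) / p < 1 := fun j =>
    ⟨by positivity, (div_lt_one hp').2 (by exact_mod_cast j.2)⟩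
  -- `B` exceeds |x| on [`u`, `v`], so taking y in [0, 1/`B`) keeps xy > -1.
  set B := |u| + |v| + 1 with hB
  have hBpos : 0 < B := by positivity
  have hmem : ∀ j : Fin p, u + (v - u) * ((j : ℕ) / (p : ℝ)) ∈ Set.Icc u v := by
    intro j
    obtain ⟨h1, h2⟩ := hfrac j
    constructor <;> nlinarith
  refine ⟨fun j => u + (v - u) * ((j : ℕ) / (p : ℝ)), fun k => 1 / B * ((k : ℕ) / (p : ℝ)),
    (hmono _ (sub_pos.2 huv)).const_add u, hmono _ (by positivity),
    fun j => hI.out hu hv (hmem j), fun j k => ?_⟩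
  obtain ⟨h1, h2⟩ := hmem j
  obtain ⟨h3, h4⟩ := hfrac k
  set s := u + (v - u) * ((j : ℕ) / (p : ℝ))
  set r := ((k : ℕ) : ℝ) / p
  have hs : -B < s := by linarith [neg_abs_le u, abs_nonneg v]
  have e : 1 + s * (1 / B * r) = (B + s * r) / B := by field_simp
  rw [e]
  exact div_pos (by nlinarith) hBpos

/-! ### The main theorem -/

theorem theoremC (p : ℕ) (hp : 2 ≤ p) (α : ℝ) (hα : 0 ≤ α) :
    -- (1) powers `α ≥ p - 2` are `TN_p` on the plane
    ((p : ℝ) - 2 ≤ α → IsTNOrder p (fun x y : ℝ => jksPow α x y)) ∧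
    -- (2) necessary condition on the plane
    (IsTNOrder p (fun x y : ℝ => jksPow α x y) → (∃ n : ℕ, α = n) ∨ (p : ℝ) - 2 ≤ α) ∧
    -- (2), stronger form: every individual `p × p` matrix drawn from `K` with positive entries
    (∀ x y : Fin p → ℝ, StrictMono x → StrictMono y → (∀ j k, 0 < 1 + x j * y k) →
      ((p : ℝ) - 2 < α → IsTP (fun j k : Fin p => jksPow α (x j) (y k))) ∧
      ((∃ n : ℕ, n + 2 ≤ p ∧ α = n) → IsTN (fun j k : Fin p => jksPow α (x j) (y k))) ∧
      (0 < α → α < (p : ℝ) - 2 → (∀ n : ℤ, α ≠ n) →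
        ¬ IsTN (fun j k : Fin p => jksPow α (x j) (y k)))) ∧
    -- (3) half-planes: `I` is a nondegenerate interval on one side of the origin
    (∀ I : Set ℝ, I.OrdConnected → I.Nontrivial → (I ⊆ Set.Ici 0 ∨ I ⊆ Set.Iic 0) →
      (IsTNOrder p (fun (x : I) (y : ℝ) => jksPow α x y) ↔
        (∃ n : ℕ, α = n) ∨ (p : ℝ) - 2 ≤ α) ∧
      (IsTNOrder p (fun (x : ℝ) (y : I) => jksPow α x y) ↔
        (∃ n : ℕ, α = n) ∨ (p : ℝ) - 2 ≤ α) ∧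
      ((∃ n : ℕ, α = n) →
        IsTN (fun (x : I) (y : ℝ) => jksPow α x y) ∧
        IsTN (fun (x : ℝ) (y : I) => jksPow α x y))) := by
  have dich : ¬ ((∃ n : ℕ, α = n) ∨ (p : ℝ) - 2 ≤ α) →
      0 < α ∧ α < (p : ℝ) - 2 ∧ ∀ n : ℕ, α ≠ n := by
    intro h
    push Not at h
    exact ⟨hα.lt_of_ne fun h0 => h.1 0 (by simp [← h0]), h.2, h.1⟩
  have tnp : (p : ℝ) - 2 ≤ α → ∀ r ≤ p, ∀ x y : Fin r → ℝ, StrictMono x → StrictMono y →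
      0 ≤ (Matrix.of fun j k => jksPow α (x j) (y k)).det := by
    intro h r hr x y hx hy
    have : (r : ℝ) ≤ p := by exact_mod_cast hr
    exact det_jksPow_nonneg (by linarith) hx hy
  have necessary : ∀ I J : Set ℝ, (∀ x y : Fin p → ℝ, StrictMono x → StrictMono y →
      (∀ j, x j ∈ I) → (∀ k, y k ∈ J) → (∀ j k, 0 < 1 + x j * y k) →
      IsTNOrder p (fun (x : I) (y : J) => jksPow α x y) → (∃ n : ℕ, α = n) ∨ (p : ℝ) - 2 ≤ α) := by
    intro I J x y hx hy hxI hyJ hpos h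
    by_contra hcon
    obtain ⟨h0, h1, h2⟩ := dich hcon
    refine not_isTNOrder_of_one_add_mul_pos h0 h1 h2 hx hy hpos fun r hr hrp f hf g hg => ?_
    exact h r hr hrp (fun j => ⟨x (f j), hxI _⟩) (fun i j hij => hx (hf hij))
      (fun k => ⟨y (g k), hyJ _⟩) (fun i j hij => hy (hg hij))
  refine ⟨fun h r _ hrp x hx y hy => tnp h r hrp x y hx hy, ?_, ?_, ?_⟩
  · intro h
    obtain ⟨x, y, hx, hy, -, hpos⟩ :=
      exists_strictMono_one_add_mul_pos Set.ordConnected_univ (Set.nontrivial_univ (α := ℝ)) p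
    exact necessary Set.univ Set.univ x y hx hy (fun _ => trivial) (fun _ => trivial) hpos
      fun r hr hrp f hf g hg => h r hr hrp (fun j => f j) hf (fun k => g k) hg
  · intro x y hx hy hpos
    refine ⟨?_, ?_, ?_⟩
    · intro h q _ r _ _ f hf g hg
      have hr : (r : ℝ) ≤ p := by
        exact_mod_cast (by simpa using Fintype.card_le_of_injective f hf.injective : r ≤ p)
      simp only [jksPow_of_pos _ (hpos _ _)]
      exact det_one_add_mul_rpow_pos r (by linarith) (hx.comp hf) (hy.comp hg) fun j k => hpos _ _
    · rintro ⟨n, -, rfl⟩ q _ r _ _ f hf g hg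
      simp only [jksPow_of_pos _ (hpos _ _)]
      -- Minors of order below n + 2 are positive; all larger ones vanish.
      rcases lt_or_ge r (n + 2) with h | h
      · have : (r : ℝ) < n + 2 := by exact_mod_cast h
        exact (det_one_add_mul_rpow_pos r (by linarith) (hx.comp hf) (hy.comp hg)
          fun j k => hpos _ _).le
      · exact (det_one_add_mul_natCast_rpow_eq_zero n h (hx.comp hf) (hy.comp hg)
          fun j k => hpos _ _).ge
    · intro h0 h1 h2 h
      exact not_isTNOrder_of_one_add_mul_pos h0 h1 (fun n => by exact_mod_cast h2 n) hx hy hpos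
        (h p (by omega))
  · intro I hI hI' hside
    have side : ∀ {r : ℕ} (f : Fin r → I), (∀ k, 0 ≤ (f k : ℝ)) ∨ ∀ k, (f k : ℝ) ≤ 0 := by
      intro r f
      exact hside.imp (fun h k => h (f k).2) (fun h k => h (f k).2)
    have natRight : (∃ n : ℕ, α = n) → IsTN (fun (x : ℝ) (y : I) => jksPow α x y) := by
      rintro ⟨n, rfl⟩ q _ r _ _ f hf g hg
      exact det_jksPow_natCast_nonneg n (y := fun k => (g k : ℝ)) hf hg (side g)
    have natLeft : (∃ n : ℕ, α = n) → IsTN (fun (x : I) (y : ℝ) => jksPow α x y) := by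
      rintro ⟨n, rfl⟩ q _ r _ _ f hf g hg
      rw [det_jksPow_swap n (fun j => (f j : ℝ)) g]
      exact det_jksPow_natCast_nonneg n (y := fun k => (f k : ℝ)) hg hf (side f)
    obtain ⟨x, y, hx, hy, hxI, hpos⟩ := exists_strictMono_one_add_mul_pos hI hI' p
    refine ⟨⟨?_, ?_⟩, ⟨?_, ?_⟩, fun h => ⟨natLeft h, natRight h⟩⟩
    · intro h
      exact necessary I Set.univ x y hx hy hxI (fun _ => trivial) hpos
        fun r hr hrp f hf g hg => h r hr hrp f hf (fun k => g k) hg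
    · rintro (h | h)
      · exact natLeft h p (by omega)
      · exact fun r _ hrp f hf g hg => tnp h r hrp (fun j => f j) g hf hg
    · intro h
      exact necessary Set.univ I y x hy hx (fun _ => trivial) hxI
        (fun j k => by rw [mul_comm]; exact hpos k j)
        fun r hr hrp f hf g hg => h r hr hrp (fun j => f j) hf g hg
    · rintro (h | h)
      · exact natRight h p (by omega)
      · exact fun r _ hrp f hf g hg => tnp h r hrp f (fun k => g k) hf hg
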